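/- Let $p$ be a prime and let $G$ be a finite $p$-solvable group, i.e. a finite group having a series $1=S_0\trianglelefteq S_1\trianglelefteq\dots\trianglelefteq S_n=G$ in which every factor $S_{i+1}/S_i$ is a $p$-group or a $p'$-group (a group of order not divisible by $p$). Let $M$ be a non-normal maximal subgroup of $G$ with $|G:M|=p^{\alpha}$. Let $\mathrm{Core}_G M=\bigcap_{g\in G}M^g$ be the largest normal subgroup of $G$ contained in $M$, and let $F(X)$ denote the Fitting subgroup of a finite group $X$, i.e. its largest nilpotent normal subgroup. Then: 1) for every prime $q$ dividing $|F(M/\mathrm{Core}_G M)|$ there is a Sylow $q$-subgroup $Q$ of $G$ with $N_G(Q)\subseteq M$; 2) if $F(M/\mathrm{Core}_G M)=1$, then there is a Hall $p'$-subgroup $K$ of $G$ (a subgroup whose order is not divisible by $p$ and whose index is a power of $p$) with $N_G(K)\subseteq M$. -/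

import Mathlib

/-- `n` is a `π`-number: every prime divisor of `n` lies in `π`. -/
def IsPiNumber (π : Set ℕ) (n : ℕ) : Prop :=
  ∀ r : ℕ, r.Prime → r ∣ n → r ∈ π

/-- `H` is a Hall `π`-subgroup of the finite group `G`: its order is a `π`-number and its index
is a `π'`-number. -/
def IsHallSubgroup {G : Type*} [Group G] (π : Set ℕ) (H : Subgroup G) : Prop :=
  IsPiNumber π (Nat.card H) ∧ IsPiNumber πᶜ H.index

/-- The finite group `G` is `p`-solvable: it has a series
`1 = S 0 ⊴ S 1 ⊴ ⋯ ⊴ S n = G` (each term normal in the next one) in which every factor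
`S (i + 1) / S i` is a `p`-group or a `p'`-group. -/
def IsPSolvable (p : ℕ) (G : Type*) [Group G] : Prop :=
  ∃ (n : ℕ) (S : ℕ → Subgroup G), S 0 = ⊥ ∧ S n = ⊤ ∧
    ∀ i < n, S i ≤ S (i + 1) ∧ ((S i).subgroupOf (S (i + 1))).Normal ∧
      (IsPiNumber {p} (Nat.card (S (i + 1) ⧸ (S i).subgroupOf (S (i + 1)))) ∨
        IsPiNumber {p}ᶜ (Nat.card (S (i + 1) ⧸ (S i).subgroupOf (S (i + 1)))))

/-- The Fitting subgroup `F(G)` of a finite group: the subgroup generated by all nilpotent normal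
subgroups of `G`. -/
def fittingSubgroup (G : Type*) [Group G] : Subgroup G :=
  sSup {N : Subgroup G | N.Normal ∧ Group.IsNilpotent N}

/-! Factor out the core, so that `M` is core-free. A normal `p'`-subgroup `P ≠ 1` of `G` is
impossible, since `P M = G` would make `|G:M|` divide `|P|`. By `p`-solvability there is thus a
normal `p`-subgroup `P ≠ 1`; its centre `V` is an abelian normal complement to `M`. Let `1 ≠ R ⊴ M`.
Then `C_V(R)` is normal in `G`; were it nontrivial, `G = C_V(R) M` would normalize `R ≤ M`, against
core-freeness. So `C_V(R) = 1`. If `R ≤ K ≤ M` and `x = v m` normalizes `K`, then `[v, r] ∈ V ∩ M =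
1` for every `r ∈ R`; hence `v = 1` and `x ∈ M`. A normal `p`-subgroup `R ≠ 1` of `M` would fix a
nontrivial element of `V`, so there is none. For `p ∉ π`, a Hall `π`-subgroup of `M` is Hall in `G`
and, modulo the core, contains each normal `π`-subgroup `R`. Take `π = {q}` for 1) and `π = p'` for
2). -/

namespace IsPiNumber

theorem of_dvd {π : Set ℕ} {m n : ℕ} (hn : IsPiNumber π n) (h : m ∣ n) : IsPiNumber π m :=
  fun r hr hrm => hn r hr (hrm.trans h)

theorem mul {π : Set ℕ} {m n : ℕ} (hm : IsPiNumber π m) (hn : IsPiNumber π n) :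
    IsPiNumber π (m * n) :=
  fun r hr h => (hr.dvd_mul.1 h).elim (hm r hr) (hn r hr)

theorem one (π : Set ℕ) : IsPiNumber π 1 :=
  fun _ hr h => absurd (Nat.dvd_one.1 h) hr.ne_one

theorem coprime {π : Set ℕ} {m n : ℕ} (hm : IsPiNumber π m) (hn : IsPiNumber πᶜ n) :
    Nat.Coprime m n :=
  Nat.coprime_of_dvd fun r hr h1 h2 => hn r hr h2 (hm r hr h1)

theorem prime_pow {π : Set ℕ} {p : ℕ} (hp : p.Prime) (h : p ∈ π) (k : ℕ) :
    IsPiNumber π (p ^ k) := fun r hr hd => by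
  rwa [(Nat.prime_dvd_prime_iff_eq hr hp).1 (hr.dvd_of_dvd_pow hd)]

theorem isPGroup {p : ℕ} {X : Type*} [Group X] [Finite X]
    (h : IsPiNumber {p} (Nat.card X)) : IsPGroup p X :=
  IsPGroup.of_card (n := (Nat.card X).primeFactorsList.length)
    (Nat.eq_prime_pow_of_unique_prime_dvd Nat.card_pos.ne' fun hr hd => h _ hr hd)

theorem _root_.IsPGroup.isPiNumber {p : ℕ} (hp : p.Prime) {X : Type*} [Group X] [Finite X]
    (h : IsPGroup p X) : IsPiNumber {p} (Nat.card X) := by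
  have := Fact.mk hp
  obtain ⟨n, hn⟩ := IsPGroup.iff_card.1 h
  rw [hn]
  exact prime_pow hp (Set.mem_singleton p) n

end IsPiNumber

/-! ### The radical `O_π`. -/

namespace Subgroup

variable {X : Type*} [Group X] {π : Set ℕ}

theorem isPiNumber_card_sup {A B : Subgroup X} [A.Normal]
    (hA : IsPiNumber π (Nat.card A)) (hB : IsPiNumber π (Nat.card B)) :
    IsPiNumber π (Nat.card (A ⊔ B : Subgroup X)) := by
  have h := relIndex_mul_relIndex ⊥ A (A ⊔ B) bot_le le_sup_left
  rw [relIndex_bot_left, relIndex_bot_left, relIndex_sup_left] at h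
  rw [← h]
  exact hA.mul (hB.of_dvd (relIndex_dvd_card A B))

/-- A normal `π`-subgroup lies in every Hall `π`-subgroup. -/
theorem le_of_isHallSubgroup {R K : Subgroup X} [R.Normal] (hR : IsPiNumber π (Nat.card R))
    (hK : IsHallSubgroup π K) : R ≤ K := by
  have h1 : IsPiNumber π (K.relIndex (R ⊔ K)) :=
    (isPiNumber_card_sup hR hK.1).of_dvd (relIndex_dvd_card K _)
  have h2 : IsPiNumber πᶜ (K.relIndex (R ⊔ K)) :=
    hK.2.of_dvd (relIndex_dvd_index_of_le le_sup_right)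
  have h3 := Nat.coprime_self _ |>.1 (h1.coprime h2)
  exact le_sup_left.trans (relIndex_eq_one.1 h3)

/-- The largest normal `π`-subgroup `O_π(X)`. -/
def piCore (π : Set ℕ) (X : Type*) [Group X] : Subgroup X :=
  sSup {N : Subgroup X | N.Normal ∧ IsPiNumber π (Nat.card N)}

theorem le_piCore {N : Subgroup X} (hN : N.Normal) (h : IsPiNumber π (Nat.card N)) :
    N ≤ piCore π X :=
  le_sSup ⟨hN, h⟩

instance piCore_characteristic : (piCore π X).Characteristic := by
  rw [characteristic_iff_map_le]
  intro φ
  rw [piCore, sSup_eq_iSup, map_iSup]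
  refine iSup_le fun N => ?_
  rw [map_iSup]
  refine iSup_le fun hN => ?_
  rw [← sSup_eq_iSup]
  refine le_sSup ⟨hN.1.map _ φ.surjective, ?_⟩
  rw [card_map_of_injective φ.injective]
  exact hN.2

theorem isPiNumber_card_piCore [Finite X] : IsPiNumber π (Nat.card (piCore π X)) := by
  have key : ∀ s ⊆ {N : Subgroup X | N.Normal ∧ IsPiNumber π (Nat.card N)},
      (sSup s).Normal ∧ IsPiNumber π (Nat.card (sSup s : Subgroup X)) := by
    intro s hs
    induction s, s.toFinite using Set.Finite.induction_on with
    | empty =>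
      rw [sSup_empty, card_bot]
      exact ⟨inferInstance, IsPiNumber.one π⟩
    | @insert N s _ _ ih =>
      obtain ⟨h1, h2⟩ := ih ((Set.subset_insert _ _).trans hs)
      obtain ⟨h3, h4⟩ := hs (Set.mem_insert N s)
      rw [sSup_insert]
      exact ⟨inferInstance, isPiNumber_card_sup h4 h2⟩
  exact (key _ subset_rfl).2

theorem map_piCore_le [Finite X] {Y : Type*} [Group Y] {f : Y →* X} (hf : Function.Injective f)
    (hn : f.range.Normal) : (piCore π Y).map f ≤ piCore π X := by
  have : Finite Y := Finite.of_injective f hf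
  refine le_piCore ⟨?_⟩ ?_
  · rintro _ ⟨y, hy, rfl⟩ x
    let e := MonoidHom.ofInjective hf
    -- Conjugation by `x`, transported to `Y`; it preserves the characteristic subgroup `O_π(Y)`.
    let φ : Y ≃* Y := (e.trans (MulAut.conjNormal x)).trans e.symm
    refine ⟨φ y, ?_, ?_⟩
    · have := (characteristic_iff_comap_eq.1 (piCore_characteristic (π := π) (X := Y))) φ
      rw [← this] at hy
      exact hy
    · have : e (φ y) = MulAut.conjNormal x (e y) := e.apply_symm_apply _
      exact congrArg Subtype.val this
  · rw [card_map_of_injective hf]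
    exact isPiNumber_card_piCore

theorem map_subtype_piCore_le [Finite X] {H K : Subgroup X} (hHK : H ≤ K)
    (hn : (H.subgroupOf K).Normal) :
    (piCore π H).map H.subtype ≤ (piCore π K).map K.subtype := by
  rw [← inclusion_range hHK] at hn
  rw [← subtype_comp_inclusion hHK, ← map_map]
  exact map_mono (map_piCore_le (inclusion_injective hHK) hn)

end Subgroup

/-! ### Normal and Hall subgroups of `p`-solvable groups. -/

namespace IsPSolvable

open Subgroup

variable {p : ℕ} {X : Type*} [Group X]

/-- If `O_p(X) = O_{p'}(X) = 1`, both radicals vanish in every `S i`, descending from `S n = X`.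
Climbing from `S 0 = 1`, each `S (i + 1)` equals its factor over `S i = 1`, hence equals one of its
radicals and is trivial, so `X = 1`. -/
theorem exists_normal [Finite X] [Nontrivial X] (h : IsPSolvable p X) :
    ∃ N : Subgroup X, N.Normal ∧ N ≠ ⊥ ∧
      (IsPiNumber {p} (Nat.card N) ∨ IsPiNumber {p}ᶜ (Nat.card N)) := by
  obtain ⟨n, S, h0, hn, hS⟩ := h
  by_contra! hcon
  have hcore : ∀ π : Set ℕ, (π = {p} ∨ π = {p}ᶜ) → piCore π X = ⊥ := by
    intro π hπ
    by_contra hne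
    have h1 := hcon _ inferInstance hne
    have h2 := isPiNumber_card_piCore (π := π) (X := X)
    rcases hπ with rfl | rfl
    · exact h1.1 h2
    · exact h1.2 h2
  have hdown : ∀ π : Set ℕ, (π = {p} ∨ π = {p}ᶜ) → ∀ i ≤ n,
      (piCore π (S i)).map (S i).subtype = ⊥ := by
    intro π hπ i hi
    induction hi using Nat.decreasingInduction with
    | self =>
      rw [eq_bot_iff, ← hcore π hπ]
      refine map_piCore_le (S n).subtype_injective ?_
      rw [range_subtype, hn]
      infer_instance
    | of_succ i hi ih =>
      rw [eq_bot_iff, ← ih]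
      exact map_subtype_piCore_le (hS i hi).1 (hS i hi).2.1
  have hup : ∀ i ≤ n, S i = ⊥ := by
    intro i
    induction i with
    | zero => exact fun _ => h0
    | succ i ih =>
      intro hi
      have hbot : Nat.card (S (i + 1) ⧸ (S i).subgroupOf (S (i + 1))) = Nat.card (S (i + 1)) := by
        rw [ih (by lia), ← relIndex_bot_left]
        rfl
      have key : ∀ π : Set ℕ, (π = {p} ∨ π = {p}ᶜ) → IsPiNumber π (Nat.card (S (i + 1))) →
          S (i + 1) = ⊥ := by
        intro π hπ hc
        have h1 : (⊤ : Subgroup (S (i + 1))) ≤ piCore π (S (i + 1)) :=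
          le_piCore inferInstance (by rwa [card_top])
        have h2 := hdown π hπ (i + 1) hi
        rw [top_le_iff.1 h1, ← MonoidHom.range_eq_map, range_subtype] at h2
        exact h2
      have h3 := (hS i (by lia)).2.2
      rw [hbot] at h3
      exact h3.elim (key _ (Or.inl rfl)) (key _ (Or.inr rfl))
  exact bot_ne_top ((hup n le_rfl).symm.trans hn)

theorem of_injective {Y : Type*} [Group Y] (h : IsPSolvable p X) {f : Y →* X}
    (hf : Function.Injective f) : IsPSolvable p Y := by
  obtain ⟨n, S, h0, hn, hS⟩ := h
  refine ⟨n, fun i => (S i).comap f, ?_, ?_, fun i hi => ?_⟩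
  · simpa [h0, MonoidHom.comap_bot] using (MonoidHom.ker_eq_bot_iff f).2 hf
  · simp [hn]
  · obtain ⟨h1, h2, h3⟩ := hS i hi
    have hle : (S i).comap f ≤ (S (i + 1)).comap f := comap_mono h1
    refine ⟨hle, ?_, ?_⟩
    · rw [normal_subgroupOf_iff hle]
      intro a b ha hb
      simpa using (normal_subgroupOf_iff h1).1 h2 (f a) (f b) ha hb
    · have hd : ((S i).comap f).relIndex ((S (i + 1)).comap f) ∣ (S i).relIndex (S (i + 1)) := by
        rw [relIndex_comap]
        have hm := map_comap_le f (S (i + 1))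
        rw [← relIndex_subgroupOf hm]
        -- Normality of `S i` in `S (i + 1)` makes the left side the order of a subgroup of the
        -- factor.
        exact relIndex_dvd_index_of_normal _ _
      exact h3.imp (fun h => h.of_dvd hd) (fun h => h.of_dvd hd)

theorem of_surjective {Y : Type*} [Group Y] (h : IsPSolvable p X) {f : X →* Y}
    (hf : Function.Surjective f) : IsPSolvable p Y := by
  obtain ⟨n, S, h0, hn, hS⟩ := h
  refine ⟨n, fun i => (S i).map f, ?_, ?_, fun i hi => ?_⟩
  · simp [h0]
  · simpa [hn, ← MonoidHom.range_eq_map] using MonoidHom.range_eq_top.2 hf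
  · obtain ⟨h1, h2, h3⟩ := hS i hi
    have hle : (S i).map f ≤ (S (i + 1)).map f := map_mono h1
    refine ⟨hle, ?_, ?_⟩
    · rw [normal_subgroupOf_iff hle]
      rintro _ _ ⟨a, ha, rfl⟩ ⟨b, hb, rfl⟩
      exact ⟨b * a * b⁻¹, (normal_subgroupOf_iff h1).1 h2 a b ha hb, by simp⟩
    · have hd : ((S i).map f).relIndex ((S (i + 1)).map f) ∣ (S i).relIndex (S (i + 1)) := by
        rw [← relIndex_comap]
        exact relIndex_dvd_of_le_left _ (le_comap_map f (S i))
      exact h3.imp (fun h => h.of_dvd hd) (fun h => h.of_dvd hd)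

/-- Lift a Hall subgroup of `X ⧸ N` to `H`. If `N` is a `p'`-group, `H` works; if `N` is a
`p`-group, Schur–Zassenhaus gives a complement to `N` in `H`. -/
theorem exists_isHallSubgroup [Finite X] (h : IsPSolvable p X) :
    ∃ K : Subgroup X, IsHallSubgroup {p}ᶜ K := by
  obtain ⟨n, hn⟩ : ∃ n, Nat.card X = n := ⟨_, rfl⟩
  induction n using Nat.strong_induction_on generalizing X with
  | _ n ih =>
    rcases subsingleton_or_nontrivial X with hX | hX
    · refine ⟨⊤, ?_, ?_⟩
      · rw [Nat.card_of_subsingleton (1 : (⊤ : Subgroup X))]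
        exact IsPiNumber.one _
      · rw [index_top]
        exact IsPiNumber.one _
    obtain ⟨N, hN, hne, hcard⟩ := h.exists_normal
    have hs := QuotientGroup.mk'_surjective N
    have hlt : Nat.card (X ⧸ N) < n := by
      rw [← hn, ← N.card_mul_index]
      exact lt_mul_of_one_lt_left index_ne_zero_of_finite.bot_lt (N.one_lt_card_iff_ne_bot.2 hne)
    obtain ⟨K, hK1, hK2⟩ := ih _ hlt (h.of_surjective hs) rfl
    set H := K.comap (QuotientGroup.mk' N) with hH
    have hNH : N ≤ H := by
      rw [hH]
      exact QuotientGroup.le_comap_mk' N K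
    have hHi : IsPiNumber ({p}ᶜ)ᶜ H.index := by
      rwa [hH, index_comap_of_surjective _ hs]
    have hrel : IsPiNumber {p}ᶜ (N.relIndex H) := by
      have := relIndex_ker (QuotientGroup.mk' N) (K := H)
      rw [QuotientGroup.ker_mk', hH, map_comap_eq_self_of_surjective hs] at this
      rwa [hH, this]
    have hNcard : Nat.card (N.subgroupOf H) = Nat.card N :=
      Nat.card_congr (subgroupOfEquivOfLe hNH).toEquiv
    rcases hcard with hc | hc
    · have hcop : Nat.Coprime (Nat.card (N.subgroupOf H)) (N.subgroupOf H).index := by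
        rw [hNcard]
        exact hc.coprime hrel
      obtain ⟨C, hC⟩ := exists_right_complement'_of_coprime hcop
      refine ⟨C.map H.subtype, ?_, ?_⟩
      · rw [card_map_of_injective H.subtype_injective, ← hC.symm.index_eq_card]
        exact hrel
      · rw [index_map_subtype, hC.index_eq_card, hNcard]
        refine IsPiNumber.mul ?_ hHi
        rwa [compl_compl]
    · refine ⟨H, ?_, hHi⟩
      rw [← relIndex_bot_left, ← relIndex_mul_relIndex ⊥ N H bot_le hNH, relIndex_bot_left]
      exact hc.mul hrel

end IsPSolvable

namespace Subgroup

theorem le_normalizer_of_conj_mem {G : Type*} [Group G] {H L : Subgroup G}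
    (h : ∀ x ∈ H, ∀ y ∈ L, x * y * x⁻¹ ∈ L) : H ≤ normalizer (L : Set G) := fun x hx =>
  mem_normalizer_iff.2 fun y => ⟨h x hx y, fun hy => by
    have := h x⁻¹ (inv_mem hx) _ hy
    rwa [show x⁻¹ * (x * y * x⁻¹) * x⁻¹⁻¹ = y by group] at this⟩

theorem index_dvd_card_of_sup_eq_top {G : Type*} [Group G] [Finite G] {N M : Subgroup G}
    [N.Normal] (h : N ⊔ M = ⊤) : M.index ∣ Nat.card N := by
  have h1 : N.relIndex M = N.index := by rw [← relIndex_sup_left, h, relIndex_top_right]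
  have h2 := relIndex_mul_relIndex ⊥ (N ⊓ M) M bot_le inf_le_right
  rw [relIndex_bot_left, relIndex_bot_left, inf_relIndex_right, h1] at h2
  have h3 : Nat.card (N ⊓ M : Subgroup G) * M.index * N.index = Nat.card N * N.index := by
    rw [N.card_mul_index, ← M.card_mul_index, ← h2]
    ring
  exact Dvd.intro_left _ (Nat.eq_of_mul_eq_mul_right index_ne_zero_of_finite.bot_lt h3)

/-! ### Core-free maximal subgroups. -/

section Primitive

variable {G : Type*} [Group G] {M V R K : Subgroup G}

theorem eq_bot_of_le_of_normalCore_eq_bot (hcore : M.normalCore = ⊥) {N : Subgroup G}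
    (hN : N.Normal) (h : N ≤ M) : N = ⊥ :=
  eq_bot_iff.2 (hcore ▸ normal_le_normalCore.2 h)

theorem sup_eq_top_of_normalCore_eq_bot (hM : IsCoatom M) (hcore : M.normalCore = ⊥)
    {N : Subgroup G} (hN : N.Normal) (hne : N ≠ ⊥) : N ⊔ M = ⊤ :=
  hM.2 _ (right_lt_sup.2 fun h => hne (eq_bot_of_le_of_normalCore_eq_bot hcore hN h))

theorem inf_centralizer_eq_bot (hM : IsCoatom M) (hcore : M.normalCore = ⊥) [hV : V.Normal]
    (hVc : ∀ a ∈ V, ∀ b ∈ V, a * b = b * a) (hsup : V ⊔ M = ⊤) (hR : R ≠ ⊥) (hRM : R ≤ M)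
    (hMR : M ≤ normalizer (R : Set G)) : V ⊓ centralizer (R : Set G) = ⊥ := by
  set W := V ⊓ centralizer (R : Set G) with hW
  by_contra hne
  have hWV : ∀ v ∈ V, ∀ w ∈ W, v * w * v⁻¹ ∈ W := fun v hv w hw => by
    rwa [hVc v hv w hw.1, mul_inv_cancel_right]
  have hWM : ∀ m ∈ M, ∀ w ∈ W, m * w * m⁻¹ ∈ W := by
    refine fun m hm w hw => ⟨hV.conj_mem w hw.1 m, mem_centralizer_iff.2 fun r hr => ?_⟩
    have h1 : m⁻¹ * r * m⁻¹⁻¹ ∈ R := (mem_normalizer_iff.1 (hMR (inv_mem hm)) r).1 hr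
    have h2 := mem_centralizer_iff.1 hw.2 _ h1
    calc r * (m * w * m⁻¹) = m * ((m⁻¹ * r * m⁻¹⁻¹) * w) * m⁻¹ := by group
      _ = m * w * m⁻¹ * r := by rw [h2]; group
  have hWn : W.Normal := by
    rw [← normalizer_eq_top_iff, eq_top_iff, ← hsup]
    exact sup_le (le_normalizer_of_conj_mem hWV) (le_normalizer_of_conj_mem hWM)
  have hRn : R.Normal := by
    rw [← normalizer_eq_top_iff, eq_top_iff,
      ← sup_eq_top_of_normalCore_eq_bot hM hcore hWn hne]
    refine sup_le ?_ hMR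
    exact (inf_le_right.trans (centralizer_le_normalizer _))
  exact hR (eq_bot_of_le_of_normalCore_eq_bot hcore hRn hRM)

theorem normalizer_le_of_normalCore_eq_bot (hM : IsCoatom M) (hcore : M.normalCore = ⊥)
    [hV : V.Normal] (hVc : ∀ a ∈ V, ∀ b ∈ V, a * b = b * a) (hVM : V ⊓ M = ⊥)
    (hsup : V ⊔ M = ⊤) (hR : R ≠ ⊥) (hRK : R ≤ K) (hKM : K ≤ M)
    (hMR : M ≤ normalizer (R : Set G)) : normalizer (K : Set G) ≤ M := by
  intro x hx
  obtain ⟨v, hv, m, hm, rfl⟩ := mem_sup_of_normal_left.1 (hsup ▸ mem_top x)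
  have hvR : v ∈ centralizer (R : Set G) := by
    refine mem_centralizer_iff.2 fun r hr => ?_
    have h1 : m⁻¹ * r * m⁻¹⁻¹ ∈ R := (mem_normalizer_iff.1 (hMR (inv_mem hm)) r).1 hr
    have h2 := (mem_normalizer_iff.1 hx _).1 (hRK h1)
    have h3 : v * r * v⁻¹ ∈ K := by
      convert h2 using 1
      group
    have h4 : v * r * v⁻¹ * r⁻¹ ∈ V ⊓ M := by
      refine mem_inf.2 ⟨?_, mul_mem (hKM h3) (inv_mem (hKM (hRK hr)))⟩
      have : v * (r * v⁻¹ * r⁻¹) ∈ V := mul_mem hv (hV.conj_mem _ (inv_mem hv) r)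
      simpa only [mul_assoc] using this
    rw [hVM, mem_bot, mul_inv_eq_one, mul_inv_eq_iff_eq_mul] at h4
    exact h4.symm
  have h5 : v ∈ V ⊓ centralizer (R : Set G) := ⟨hv, hvR⟩
  rw [inf_centralizer_eq_bot hM hcore hVc hsup hR (hRK.trans hKM) hMR, mem_bot] at h5
  rwa [h5, one_mul]

theorem exists_normal_abelian_complement [Finite G] {p : ℕ} (hp : p.Prime)
    (hG : IsPSolvable p G) (hM : IsCoatom M) (hcore : M.normalCore = ⊥) {α : ℕ}
    (hα : M.index = p ^ α) :
    ∃ V : Subgroup G, V.Normal ∧ IsPGroup p V ∧ V ≠ ⊥ ∧ (∀ a ∈ V, ∀ b ∈ V, a * b = b * a) ∧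
      V ⊓ M = ⊥ ∧ V ⊔ M = ⊤ := by
  have := Fact.mk hp
  have : Nontrivial G := by
    by_contra h
    rw [not_nontrivial_iff_subsingleton] at h
    exact hM.1 (Subsingleton.elim _ _)
  obtain ⟨P, hP, hPne, hc⟩ := hG.exists_normal
  have hPp : IsPGroup p P := by
    refine (hc.resolve_right fun hc => hM.1 ?_).isPGroup
    have h1 := index_dvd_card_of_sup_eq_top (sup_eq_top_of_normalCore_eq_bot hM hcore hP hPne)
    have h2 : IsPiNumber {p} M.index := hα ▸ IsPiNumber.prime_pow hp (Set.mem_singleton p) α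
    have h3 : IsPiNumber {p}ᶜ M.index := hc.of_dvd h1
    exact index_eq_one.1 ((Nat.coprime_self _).1 (h2.coprime h3))
  have : Nontrivial P := (nontrivial_iff_ne_bot P).2 hPne
  set V := (center P).map P.subtype with hV
  have hVn : V.Normal := inferInstance
  have hVne : V ≠ ⊥ := by
    rw [hV, Ne, map_eq_bot_iff_of_injective _ P.subtype_injective]
    exact hPp.bot_lt_center.ne'
  have hVc : ∀ a ∈ V, ∀ b ∈ V, a * b = b * a := by
    rintro _ ⟨a, ha, rfl⟩ _ ⟨b, hb, rfl⟩
    exact congrArg P.subtype (mem_center_iff.1 hb a)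
  have hsup := sup_eq_top_of_normalCore_eq_bot hM hcore hVn hVne
  refine ⟨V, hVn, hPp.to_le (map_subtype_le _), hVne, hVc, ?_, hsup⟩
  refine eq_bot_of_le_of_normalCore_eq_bot hcore ?_ inf_le_right
  rw [← normalizer_eq_top_iff, eq_top_iff, ← hsup]
  -- `V ⊓ M` is normalized by `V`, which is abelian, and by `M`, as `V` is normal.
  refine sup_le (le_normalizer_of_conj_mem fun v hv w hw => ?_)
    (le_normalizer_of_conj_mem fun m hm w hw => ?_)
  · rwa [hVc v hv w hw.1, mul_inv_cancel_right]
  · exact mem_inf.2 ⟨hVn.conj_mem w hw.1 m, mul_mem (mul_mem hm hw.2) (inv_mem hm)⟩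

theorem eq_bot_of_isPGroup_of_le_normalizer [Finite G] {p : ℕ} (hp : p.Prime) (hM : IsCoatom M)
    (hcore : M.normalCore = ⊥) [V.Normal] (hV : IsPGroup p V) (hVne : V ≠ ⊥)
    (hVc : ∀ a ∈ V, ∀ b ∈ V, a * b = b * a) (hsup : V ⊔ M = ⊤)
    (hRM : R ≤ M) (hMR : M ≤ normalizer (R : Set G)) (hR : IsPGroup p R) : R = ⊥ := by
  have := Fact.mk hp
  by_contra hne
  have hW := inf_centralizer_eq_bot hM hcore hVc hsup hne hRM hMR
  -- Conjugation, whose fixed points are `C_V(R)`; their number is divisible by `p`.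
  let _ : MulAction R V := MulAction.compHom V ((MulAut.conjNormal (H := V)).comp R.subtype)
  have hdvd : p ∣ Nat.card V := by
    have : Nontrivial V := (nontrivial_iff_ne_bot V).2 hVne
    obtain ⟨n, hn, h⟩ := hV.nontrivial_iff_card.1 this
    exact h ▸ dvd_pow_self p hn.ne'
  have hone : (1 : V) ∈ MulAction.fixedPoints R V := fun r => by
    exact map_one (MulAut.conjNormal (r : G))
  obtain ⟨v, hv, hv1⟩ := hR.exists_fixed_point_of_prime_dvd_card_of_fixed_point V hdvd hone
  refine hv1 (Subtype.ext ?_)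
  have : (v : G) ∈ V ⊓ centralizer (R : Set G) := by
    refine ⟨v.2, mem_centralizer_iff.2 fun r hr => ?_⟩
    have h : r * v * r⁻¹ = v := congrArg Subtype.val (hv ⟨r, hr⟩)
    exact mul_inv_eq_iff_eq_mul.1 h
  rw [hW, mem_bot] at this
  exact this.symm

end Primitive

end Subgroup

/-! ### Passage to the quotient by the core. -/

namespace Subgroup

section CoreQuotient

variable {G : Type*} [Group G] (M : Subgroup G)

/-- The embedding of `M / Core_G M` into `G / Core_G M`. -/
def coreQuotientMap : M ⧸ M.normalCore.subgroupOf M →* G ⧸ M.normalCore :=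
  QuotientGroup.map (M.normalCore.subgroupOf M) M.normalCore M.subtype le_rfl

theorem coreQuotientMap_mk (m : M) :
    M.coreQuotientMap (QuotientGroup.mk' _ m) = QuotientGroup.mk' M.normalCore (m : G) :=
  rfl

theorem coreQuotientMap_injective : Function.Injective M.coreQuotientMap := by
  rw [← MonoidHom.ker_eq_bot_iff, eq_bot_iff]
  intro x hx
  obtain ⟨m, rfl⟩ := QuotientGroup.mk'_surjective _ x
  rw [MonoidHom.mem_ker, coreQuotientMap_mk, ← MonoidHom.mem_ker, QuotientGroup.ker_mk'] at hx
  rw [mem_bot, ← MonoidHom.mem_ker, QuotientGroup.ker_mk']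
  exact hx

theorem comap_map_mk'_normalCore :
    (M.map (QuotientGroup.mk' M.normalCore)).comap (QuotientGroup.mk' M.normalCore) = M :=
  comap_map_eq_self ((QuotientGroup.ker_mk' _).trans_le M.normalCore_le)

theorem isCoatom_map_mk'_normalCore {M : Subgroup G} (hM : IsCoatom M) :
    IsCoatom (M.map (QuotientGroup.mk' M.normalCore)) := by
  have hs := QuotientGroup.mk'_surjective M.normalCore
  refine ⟨fun h => hM.1 ?_, fun L hL => ?_⟩
  · rw [← M.comap_map_mk'_normalCore, h, comap_top]
  · have h1 := (comap_lt_comap_of_surjective hs).2 hL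
    rw [comap_map_mk'_normalCore] at h1
    rw [← map_comap_eq_self_of_surjective hs L, hM.2 _ h1, map_top_of_surjective _ hs]

theorem normalCore_map_mk'_normalCore :
    (M.map (QuotientGroup.mk' M.normalCore)).normalCore = ⊥ := by
  have hs := QuotientGroup.mk'_surjective M.normalCore
  set N := (M.map (QuotientGroup.mk' M.normalCore)).normalCore
  have h1 : N.comap (QuotientGroup.mk' M.normalCore) ≤ M.normalCore := by
    refine normal_le_normalCore.2 ?_
    conv_rhs => rw [← M.comap_map_mk'_normalCore]
    exact comap_mono (normalCore_le _)
  rw [← map_comap_eq_self_of_surjective hs N, map_eq_bot_iff, QuotientGroup.ker_mk']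
  exact h1

theorem map_coreQuotientMap_le (R : Subgroup (M ⧸ M.normalCore.subgroupOf M)) :
    R.map M.coreQuotientMap ≤ M.map (QuotientGroup.mk' M.normalCore) := by
  rintro _ ⟨x, -, rfl⟩
  obtain ⟨m, rfl⟩ := QuotientGroup.mk'_surjective _ x
  exact ⟨m, m.2, rfl⟩

theorem map_le_normalizer_map_coreQuotientMap (R : Subgroup (M ⧸ M.normalCore.subgroupOf M))
    [hR : R.Normal] : M.map (QuotientGroup.mk' M.normalCore) ≤
      normalizer (R.map M.coreQuotientMap : Set (G ⧸ M.normalCore)) := by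
  refine le_normalizer_of_conj_mem ?_
  rintro _ ⟨m, hm, rfl⟩ _ ⟨y, hy, rfl⟩
  exact ⟨_, hR.conj_mem y hy (QuotientGroup.mk' _ ⟨m, hm⟩), by
    rw [map_mul, map_mul, map_inv, coreQuotientMap_mk]⟩

variable {M} [Finite G] {p : ℕ}

theorem eq_bot_of_normal_of_isPGroup (hp : p.Prime) (hG : IsPSolvable p G) (hM : IsCoatom M) {α : ℕ}
    (hα : M.index = p ^ α)
    {R : Subgroup (M ⧸ M.normalCore.subgroupOf M)}
    (hR : R.Normal) (hRp : IsPGroup p R) : R = ⊥ := by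
  have hs := QuotientGroup.mk'_surjective M.normalCore
  have hM' := isCoatom_map_mk'_normalCore hM
  have hcore := M.normalCore_map_mk'_normalCore
  obtain ⟨V, hV, hVp, hVne, hVc, -, hsup⟩ := exists_normal_abelian_complement hp
    (hG.of_surjective hs) hM' hcore ((index_map_eq _ hs
      ((QuotientGroup.ker_mk' _).trans_le M.normalCore_le)).trans hα)
  rw [← map_eq_bot_iff_of_injective R M.coreQuotientMap_injective]
  exact eq_bot_of_isPGroup_of_le_normalizer hp hM' hcore hVp hVne hVc hsup
    (M.map_coreQuotientMap_le R) (M.map_le_normalizer_map_coreQuotientMap R) (hRp.map _)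

theorem normalizer_le_of_isHallSubgroup (hp : p.Prime) (hG : IsPSolvable p G) (hM : IsCoatom M) {α : ℕ}
    (hα : M.index = p ^ α)
    {π : Set ℕ} (hπ : p ∉ π)
    {R : Subgroup (M ⧸ M.normalCore.subgroupOf M)} (hR : R.Normal) (hRne : R ≠ ⊥)
    (hRπ : IsPiNumber π (Nat.card R)) {K : Subgroup M} (hK : IsHallSubgroup π K) :
    IsHallSubgroup π (K.map M.subtype) ∧
      normalizer (K.map M.subtype : Set G) ≤ M := by
  have hs := QuotientGroup.mk'_surjective M.normalCore
  have hsM := QuotientGroup.mk'_surjective (M.normalCore.subgroupOf M)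
  refine ⟨⟨?_, ?_⟩, ?_⟩
  · rw [card_map_of_injective M.subtype_injective]
    exact hK.1
  · rw [index_map_subtype, hα]
    exact hK.2.mul (IsPiNumber.prime_pow hp hπ α)
  have hM' := isCoatom_map_mk'_normalCore hM
  have hcore := M.normalCore_map_mk'_normalCore
  obtain ⟨V, hV, -, -, hVc, hVM, hsup⟩ := exists_normal_abelian_complement hp
    (hG.of_surjective hs) hM' hcore ((index_map_eq _ hs
      ((QuotientGroup.ker_mk' _).trans_le M.normalCore_le)).trans hα)
  have hRK : R ≤ K.map (QuotientGroup.mk' (M.normalCore.subgroupOf M)) :=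
    le_of_isHallSubgroup hRπ ⟨hK.1.of_dvd (card_map_dvd K _), hK.2.of_dvd (index_map_dvd _ hsM)⟩
  have hKmap : (K.map (QuotientGroup.mk' (M.normalCore.subgroupOf M))).map M.coreQuotientMap =
      (K.map M.subtype).map (QuotientGroup.mk' M.normalCore) := by
    rw [map_map, map_map]
    rfl
  have key := normalizer_le_of_normalCore_eq_bot hM' hcore hVc hVM hsup
    (mt (map_eq_bot_iff_of_injective R M.coreQuotientMap_injective).1 hRne)
    (hKmap ▸ map_mono hRK) (map_mono (map_subtype_le K))
    (M.map_le_normalizer_map_coreQuotientMap R)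
  refine le_trans ?_ M.comap_map_mk'_normalCore.le
  exact map_le_iff_le_comap.1 ((le_normalizer_map _).trans key)

end CoreQuotient

/-- The Sylow `q`-subgroup of a nilpotent normal `N` is characteristic in `N`, so normal in `X`. If
all of these were trivial, the Fitting subgroup would lie in `O_{q'}(X)`. -/
theorem exists_normal_isPGroup_of_dvd_card_fittingSubgroup {X : Type*} [Group X] [Finite X]
    {q : ℕ} (hq : q.Prime) (h : q ∣ Nat.card (fittingSubgroup X)) :
    ∃ R : Subgroup X, R.Normal ∧ R ≠ ⊥ ∧ IsPiNumber {q} (Nat.card R) := by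
  have := Fact.mk hq
  by_contra! hcon
  have hle : fittingSubgroup X ≤ piCore {q}ᶜ X := by
    refine sSup_le fun N ⟨hN, hnil⟩ => le_piCore hN fun r hr hrd hrq => ?_
    obtain rfl : r = q := hrq
    let Q : Sylow r N := default
    have hQ : (Q : Subgroup N).Normal :=
      (Group.isNilpotent_of_finite_tfae.out 0 3 rfl rfl).1 hnil r inferInstance Q
    have := Q.characteristic_of_normal hQ
    refine hcon ((Q : Subgroup N).map N.subtype) inferInstance ?_ ?_
    · rw [Ne, map_eq_bot_iff_of_injective _ N.subtype_injective]
      exact Q.ne_bot_of_dvd_card hrd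
    · exact (Q.2.map _).isPiNumber hq
  exact isPiNumber_card_piCore.of_dvd (card_dvd_of_le hle) q hq h rfl

end Subgroup

theorem theorem2 {G : Type*} [Group G] [Finite G] (p : ℕ) (hp : p.Prime)
    (hG : IsPSolvable p G) (M : Subgroup G) (hM : IsCoatom M) (hMn : ¬ M.Normal)
    (α : ℕ) (hα : M.index = p ^ α) :
    (∀ q : ℕ, q.Prime →
        q ∣ Nat.card (fittingSubgroup (M ⧸ M.normalCore.subgroupOf M)) →
        ∃ Q : Sylow q G, Subgroup.normalizer (Q : Set G) ≤ M) ∧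
    (fittingSubgroup (M ⧸ M.normalCore.subgroupOf M) = ⊥ →
        ∃ K : Subgroup G, IsHallSubgroup {p}ᶜ K ∧ Subgroup.normalizer (K : Set G) ≤ M) := by
  have := Fact.mk hp
  constructor
  · intro q hq hdvd
    have := Fact.mk hq
    obtain ⟨R, hR, hRne, hRq⟩ :=
      Subgroup.exists_normal_isPGroup_of_dvd_card_fittingSubgroup hq hdvd
    have hpq : p ∉ ({q} : Set ℕ) := by
      rintro rfl
      exact hRne (Subgroup.eq_bot_of_normal_of_isPGroup hp hG hM hα hR hRq.isPGroup)
    let Q : Sylow q M := default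
    have hQ : IsHallSubgroup {q} (Q : Subgroup M) :=
      ⟨Q.2.isPiNumber hq, fun r _ hr hrq => Q.not_dvd_index (hrq ▸ hr)⟩
    obtain ⟨h1, h2⟩ := Subgroup.normalizer_le_of_isHallSubgroup hp hG hM hα hpq hR hRne hRq hQ
    exact ⟨h1.1.isPGroup.toSylow fun h => h1.2 q hq h rfl, h2⟩
  · intro hF
    -- Otherwise `M` equals its core and is normal.
    have hnt : Nontrivial (M ⧸ M.normalCore.subgroupOf M) := by
      by_contra h
      rw [not_nontrivial_iff_subsingleton, QuotientGroup.subsingleton_iff,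
        Subgroup.subgroupOf_eq_top] at h
      exact hMn (le_antisymm h M.normalCore_le ▸ M.normalCore_normal)
    have hMp : IsPSolvable p M := hG.of_injective M.subtype_injective
    obtain ⟨R, hR, hRne, hRc⟩ :=
      (hMp.of_surjective (QuotientGroup.mk'_surjective (M.normalCore.subgroupOf M))).exists_normal
    have hRp' := hRc.resolve_left fun h => hRne <| by
      have := h.isPGroup.isNilpotent
      exact eq_bot_iff.2 (hF ▸ le_sSup ⟨hR, this⟩)
    obtain ⟨K, hK⟩ := hMp.exists_isHallSubgroup
    exact ⟨_, Subgroup.normalizer_le_of_isHallSubgroup hp hG hM hα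
      (Set.notMem_compl_iff.2 (Set.mem_singleton p)) hR hRne hRp' hK⟩
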